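/- Let $\zeta$ be the Riemann zeta function and let $a\in\mathbb C$ with $\operatorname{Re}a>0$. (i) For every real $b\ge 1$, $$\int_0^\infty \frac{1}{x^2+a^2}\,\operatorname{Re}\!\left(\frac{e^{-ix}}{\zeta(b+ix)}\right)dx=\frac{\pi e^{-a}}{2a\,\zeta(a+b)}.$$ (ii) More generally, for every $b\in\mathbb C$ with $\operatorname{Re}b\ge 1$, $$\int_0^\infty \frac{1}{x^2+a^2}\cdot\frac12\left(\frac{e^{-ix}}{\zeta(b+ix)}+\frac{e^{ix}}{\zeta(b-ix)}\right)dx=\frac{\pi e^{-a}}{2a\,\zeta(a+b)}.$$ Both integrals converge absolutely. (At the at most one point $x\ge 0$ where $b+ix$ or $b-ix$ is the pole $1$ of $\zeta$, the integrand may be given any value.) -/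

import Mathlib

section

open Complex MeasureTheory Set Filter Topology

/-! For `Re b > 1` expand `1/ζ(b+ix) = ∑ μ(n) n^{-b-ix}`. Since `e^{-ix} n^{-ix} = e^{-i(1+log n)x}`
has frequency `1 + log n ≥ 0`, its integral over ℝ against `1/(x²+a²)` is `(π/a) e^{-a} n^{-a}`, and
summing over `n` produces `1/ζ(a+b)` (`integral_exp_div_riemannZeta_of_one_lt_re`). Folding ℝ onto
the half-line turns the integrand into the symmetric half-sum.

On `Re b = 1` absolute convergence of the series is lost, so `b` is replaced by `b + ε` with `ε →
0⁺`. Dominated convergence needs `1/ζ(σ+it) = O(|t|^θ)` for some `θ < 1`, uniformly as `σ → 1⁺`.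
Here `θ = 1/2` (`exists_norm_inv_riemannZeta_le`): comparing `∑ n^{-s}` with `∫ x^{-s}` bounds `ζ(s)
- 1/(s-1)` by `|s|^{1/8}` slightly to the left of the line, Cauchy's estimate makes `ζ` Lipschitz in
`σ` at the same cost, and the 3-4-1 inequality then bounds `|ζ|` below. -/

/-! ### Growth of `ζ` near the line `Re s = 1` -/

/-- Geometric interpolation of two upper bounds with weights `7/8` and `1/8`. -/
theorem le_rpow_mul_rpow_of_le_of_le {y A B : ℝ} (hy : 0 ≤ y) (hA : y ≤ A) (hB : y ≤ B) :
    y ≤ A ^ (7 / 8 : ℝ) * B ^ (1 / 8 : ℝ) := by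
  calc y = y ^ (7 / 8 : ℝ) * y ^ (1 / 8 : ℝ) := by
        rw [← Real.rpow_add_of_nonneg hy (by norm_num) (by norm_num)]; norm_num
    _ ≤ _ := by gcongr; exact Real.rpow_nonneg (hy.trans hA) _

/-- Interpolates the trivial bound `2 n^{-σ}` with the mean value bound `|s| n^{-σ-1}`. Weight `1/8`
on the latter costs only `|s|^{1/8}`, and the gain `n^{-1/8}` still gives a summable exponent
`-17/16` at `σ = 15/16`. -/
theorem norm_cpow_neg_sub_cpow_neg_le {n x : ℝ} (hn : 0 < n) (hx : x ∈ Icc n (n + 1)) {s : ℂ}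
    (hs : 0 ≤ s.re) :
    ‖(n : ℂ) ^ (-s) - (x : ℂ) ^ (-s)‖ ≤ 2 * ‖s‖ ^ (1 / 8 : ℝ) * n ^ (-s.re - 1 / 8) := by
  have hx0 : 0 < x := hn.trans_le hx.1
  have hA : ‖(n : ℂ) ^ (-s) - (x : ℂ) ^ (-s)‖ ≤ 2 * n ^ (-s.re) := by
    refine (norm_sub_le _ _).trans ?_
    rw [norm_cpow_eq_rpow_re_of_pos hn, norm_cpow_eq_rpow_re_of_pos hx0, neg_re]
    have := Real.rpow_le_rpow_of_nonpos hn hx.1 (by linarith : -s.re ≤ 0)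
    linarith
  have hB : ‖(n : ℂ) ^ (-s) - (x : ℂ) ^ (-s)‖ ≤ ‖s‖ * n ^ (-s.re - 1) := by
    by_cases hs0 : s = 0
    · simp [hs0]
    have hd : ∀ y ∈ Icc n (n + 1), HasDerivWithinAt (fun y : ℝ => (y : ℂ) ^ (-s))
        (-s * (y : ℂ) ^ (-s - 1)) (Icc n (n + 1)) y := fun y hy =>
      (hasDerivAt_ofReal_cpow_const (hn.trans_le hy.1).ne' (neg_ne_zero.2 hs0)).hasDerivWithinAt
    have hb : ∀ y ∈ Icc n (n + 1), ‖-s * (y : ℂ) ^ (-s - 1)‖ ≤ ‖s‖ * n ^ (-s.re - 1) := by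
      intro y hy
      rw [norm_mul, norm_neg, norm_cpow_eq_rpow_re_of_pos (hn.trans_le hy.1)]
      gcongr
      simpa using Real.rpow_le_rpow_of_nonpos hn hy.1 (by linarith : -s.re - 1 ≤ 0)
    have := (convex_Icc n (n + 1)).norm_image_sub_le_of_norm_hasDerivWithin_le hd hb hx
      (left_mem_Icc.2 (by linarith))
    refine this.trans (mul_le_of_le_one_right (by positivity) ?_)
    rw [Real.norm_eq_abs, abs_le]
    constructor <;> linarith [hx.1, hx.2]
  refine (le_rpow_mul_rpow_of_le_of_le (norm_nonneg _) hA hB).trans ?_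
  rw [Real.mul_rpow (by norm_num) (by positivity), Real.mul_rpow (by positivity) (by positivity),
    ← Real.rpow_mul hn.le, ← Real.rpow_mul hn.le]
  have h2 : (2 : ℝ) ^ (7 / 8 : ℝ) ≤ 2 :=
    Real.rpow_le_self_of_one_le (by norm_num) (by norm_num)
  have h3 : n ^ (-s.re * (7 / 8)) * n ^ ((-s.re - 1) * (1 / 8)) = n ^ (-s.re - 1 / 8) := by
    rw [← Real.rpow_add hn]; ring_nf
  calc _ = (2 : ℝ) ^ (7 / 8 : ℝ) * ‖s‖ ^ (1 / 8 : ℝ) *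
        (n ^ (-s.re * (7 / 8)) * n ^ ((-s.re - 1) * (1 / 8))) := by ring
    _ ≤ _ := by rw [h3]; gcongr

/-- The error of the rectangle rule for `∫ x ^ (-s)` on `[n + 1, n + 2]`. -/
noncomputable def zetaRectangleError (n : ℕ) (s : ℂ) : ℂ :=
  ((n + 1 : ℝ) : ℂ) ^ (-s) - ∫ x in (n + 1 : ℝ)..(n + 1 + 1 : ℝ), (x : ℂ) ^ (-s)

theorem zetaRectangleError_eq {n : ℕ} {s : ℂ} (hs : s ≠ 1) :
    zetaRectangleError n s = ((n + 1 : ℝ) : ℂ) ^ (-s) -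
      (((n + 1 + 1 : ℝ) : ℂ) ^ (-s + 1) - ((n + 1 : ℝ) : ℂ) ^ (-s + 1)) / (-s + 1) := by
  rw [zetaRectangleError, integral_cpow]
  right
  refine ⟨fun h => hs (by simpa using h), ?_⟩
  rw [uIcc_of_le (by linarith)]
  intro h
  have := h.1
  have : (0 : ℝ) < n + 1 := by positivity
  linarith

theorem norm_zetaRectangleError_le (n : ℕ) {s : ℂ} (hs : 0 ≤ s.re) :
    ‖zetaRectangleError n s‖ ≤ 2 * ‖s‖ ^ (1 / 8 : ℝ) * (n + 1 : ℝ) ^ (-s.re - 1 / 8) := by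
  have hn : (0 : ℝ) < n + 1 := by positivity
  have hint : IntervalIntegrable (fun x : ℝ => (x : ℂ) ^ (-s)) volume (n + 1) (n + 1 + 1) := by
    apply intervalIntegral.intervalIntegrable_cpow
    right
    rw [uIcc_of_le (by linarith)]
    intro h
    linarith [h.1]
  have : zetaRectangleError n s = ∫ x in (n + 1 : ℝ)..(n + 1 + 1 : ℝ),
      (((n + 1 : ℝ) : ℂ) ^ (-s) - (x : ℂ) ^ (-s)) := by
    rw [intervalIntegral.integral_sub (by simp) hint, zetaRectangleError]
    simp
  rw [this]
  have key := intervalIntegral.norm_integral_le_of_norm_le_const (a := (n + 1 : ℝ))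
    (b := n + 1 + 1) (C := 2 * ‖s‖ ^ (1 / 8 : ℝ) * (n + 1 : ℝ) ^ (-s.re - 1 / 8))
    (f := fun x : ℝ => ((n + 1 : ℝ) : ℂ) ^ (-s) - (x : ℂ) ^ (-s)) (fun x hx => by
      rw [uIoc_of_le (by linarith)] at hx
      exact norm_cpow_neg_sub_cpow_neg_le hn ⟨hx.1.le, hx.2⟩ hs)
  simpa using key

theorem differentiableOn_zetaRectangleError (n : ℕ) :
    DifferentiableOn ℂ (zetaRectangleError n) {1}ᶜ := by
  have hn : ((n + 1 : ℝ) : ℂ) ≠ 0 := by norm_cast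
  have hn' : ((n + 1 + 1 : ℝ) : ℂ) ≠ 0 := by norm_cast
  refine DifferentiableOn.congr (f := fun s => ((n + 1 : ℝ) : ℂ) ^ (-s) -
      (((n + 1 + 1 : ℝ) : ℂ) ^ (-s + 1) - ((n + 1 : ℝ) : ℂ) ^ (-s + 1)) / (-s + 1)) ?_
    fun s hs => zetaRectangleError_eq hs
  intro s hs
  apply DifferentiableAt.differentiableWithinAt
  have hs' : -s + 1 ≠ 0 := fun h => hs (by
    simp only [mem_singleton_iff]; linear_combination -h)
  have h1 : DifferentiableAt ℂ (fun s : ℂ => -s) s := differentiableAt_id.neg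
  have h2 : DifferentiableAt ℂ (fun s : ℂ => -s + 1) s := h1.add_const 1
  exact (h1.const_cpow (Or.inl hn)).sub
    (((h2.const_cpow (Or.inl hn')).sub (h2.const_cpow (Or.inl hn))).div h2 hs')

theorem summable_nat_add_one_rpow {p : ℝ} (hp : p < -1) :
    Summable fun n : ℕ => (n + 1 : ℝ) ^ p := by
  have := (summable_nat_add_iff 1).2 (Real.summable_nat_rpow.2 hp)
  simpa using this

theorem norm_zetaRectangleError_le_of_le_re (n : ℕ) {s : ℂ} (hs : 15 / 16 ≤ s.re) :
    ‖zetaRectangleError n s‖ ≤ 2 * ‖s‖ ^ (1 / 8 : ℝ) * (n + 1 : ℝ) ^ (-(17 / 16) : ℝ) := by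
  refine (norm_zetaRectangleError_le n (by linarith)).trans ?_
  gcongr
  · linarith [(Nat.cast_nonneg n : (0 : ℝ) ≤ n)]
  · linarith

theorem summable_zetaRectangleError {s : ℂ} (hs : 15 / 16 ≤ s.re) :
    Summable fun n => zetaRectangleError n s :=
  .of_norm_bounded ((summable_nat_add_one_rpow (by norm_num)).mul_left _)
    fun n => norm_zetaRectangleError_le_of_le_re n hs

/-- The integrals over consecutive unit intervals telescope to `∫_1^∞ x^{-s} dx = 1/(s-1)`. -/
theorem riemannZeta_eq_inv_sub_one_add_tsum {s : ℂ} (hs : 1 < s.re) :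
    riemannZeta s = 1 / (s - 1) + ∑' n, zetaRectangleError n s := by
  have hs1 : s ≠ 1 := by rintro rfl; simp at hs
  have hs1' : -s + 1 ≠ 0 := fun h => hs1 (by linear_combination -h)
  have hz := zeta_eq_tsum_one_div_nat_add_one_cpow hs
  have hsum : Summable fun n : ℕ => 1 / ((n : ℂ) + 1) ^ s := by
    have := (summable_nat_add_iff 1).2 (Complex.summable_one_div_nat_cpow.2 hs)
    simpa using this
  have h1 : HasSum (fun n : ℕ => ((n + 1 : ℝ) : ℂ) ^ (-s)) (riemannZeta s) := by
    rw [hz]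
    convert hsum.hasSum using 2 with n
    rw [cpow_neg]; simp
  have h0 : Tendsto (fun n : ℕ => ((n + 1 : ℝ) : ℂ) ^ (-s + 1)) atTop (𝓝 0) := by
    rw [tendsto_zero_iff_norm_tendsto_zero]
    have : ∀ n : ℕ, ‖((n + 1 : ℝ) : ℂ) ^ (-s + 1)‖ = (n + 1 : ℝ) ^ (-(s.re - 1)) := fun n => by
      rw [norm_cpow_eq_rpow_re_of_pos (by positivity)]; simp; ring_nf
    simp only [this]
    exact (tendsto_rpow_neg_atTop (by linarith)).comp
      (tendsto_atTop_add_const_right _ _ tendsto_natCast_atTop_atTop)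
  have h2 : HasSum (fun n : ℕ => (((n + 1 + 1 : ℝ) : ℂ) ^ (-s + 1) -
      ((n + 1 : ℝ) : ℂ) ^ (-s + 1)) / (-s + 1)) ((0 - 1) / (-s + 1)) := by
    have hS : Summable (fun n : ℕ => (((n + 1 + 1 : ℝ) : ℂ) ^ (-s + 1) -
        ((n + 1 : ℝ) : ℂ) ^ (-s + 1)) / (-s + 1)) := by
      refine (h1.summable.sub (summable_zetaRectangleError (s := s) (by linarith))).congr
        fun n => ?_
      rw [zetaRectangleError_eq hs1]; ring
    rw [hS.hasSum_iff_tendsto_nat]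
    simp only [← Finset.sum_div]
    have : ∀ N : ℕ, ∑ n ∈ Finset.range N, (((n + 1 + 1 : ℝ) : ℂ) ^ (-s + 1) -
        ((n + 1 : ℝ) : ℂ) ^ (-s + 1)) = ((N + 1 : ℝ) : ℂ) ^ (-s + 1) - 1 := fun N => by
      have := Finset.sum_range_sub (fun n : ℕ => ((n + 1 : ℝ) : ℂ) ^ (-s + 1)) N
      simpa using this
    simp only [this]
    exact (h0.sub_const 1).div_const _
  have h3 := h1.sub h2
  have h4 : ∑' n, zetaRectangleError n s = riemannZeta s - (0 - 1) / (-s + 1) := by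
    rw [← h3.tsum_eq]
    exact tsum_congr fun n => zetaRectangleError_eq hs1
  have h5 : s - 1 ≠ 0 := sub_ne_zero.2 hs1
  rw [h4]
  field_simp
  ring

/-- The constant in the bound for `∑' n, zetaRectangleError n s`. -/
noncomputable def zetaGrowthConst : ℝ := 2 * ∑' n : ℕ, (n + 1 : ℝ) ^ (-(17 / 16) : ℝ)

theorem zetaGrowthConst_nonneg : 0 ≤ zetaGrowthConst :=
  mul_nonneg (by norm_num) (tsum_nonneg fun n => by positivity)

theorem norm_tsum_zetaRectangleError_le {s : ℂ} (hs : 15 / 16 ≤ s.re) :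
    ‖∑' n, zetaRectangleError n s‖ ≤ zetaGrowthConst * ‖s‖ ^ (1 / 8 : ℝ) := by
  have h := tsum_of_norm_bounded
    (((summable_nat_add_one_rpow (p := -(17 / 16)) (by norm_num)).mul_left
      (2 * ‖s‖ ^ (1 / 8 : ℝ))).hasSum) fun n => norm_zetaRectangleError_le_of_le_re n hs
  rw [tsum_mul_left] at h
  rw [zetaGrowthConst]
  linarith

theorem differentiableOn_tsum_zetaRectangleError :
    DifferentiableOn ℂ (fun s => ∑' n, zetaRectangleError n s) ({s | 15 / 16 < s.re} \ {1}) := by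
  have hopen : IsOpen ({s : ℂ | 15 / 16 < s.re} \ {1}) :=
    (isOpen_lt continuous_const continuous_re).sdiff isClosed_singleton
  intro s hs
  -- The majorant grows with `‖s‖`; a ball makes it uniform.
  have hV : IsOpen (({s : ℂ | 15 / 16 < s.re} \ {1}) ∩ Metric.ball 0 (‖s‖ + 1)) :=
    hopen.inter Metric.isOpen_ball
  have hmem : s ∈ ({s : ℂ | 15 / 16 < s.re} \ {1}) ∩ Metric.ball 0 (‖s‖ + 1) :=
    ⟨hs, by simp⟩
  have := differentiableOn_tsum_of_summable_norm (F := zetaRectangleError)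
    ((summable_nat_add_one_rpow (p := -(17 / 16)) (by norm_num)).mul_left
      (2 * (‖s‖ + 1) ^ (1 / 8 : ℝ)))
    (fun n => (differentiableOn_zetaRectangleError n).mono fun z hz => hz.1.2) hV
    (fun n z hz => (norm_zetaRectangleError_le_of_le_re n (le_of_lt hz.1.1)).trans (by
      have := hz.2
      rw [mem_ball_zero_iff] at this
      gcongr))
  exact ((this s hmem).differentiableAt (hV.mem_nhds hmem)).differentiableWithinAt

/-- Cauchy's estimate on a disc of radius `1/32`: it stays in `Re > 15/16`, and `|Im s| ≥ 1` keeps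
it away from `1`. -/
theorem norm_deriv_tsum_zetaRectangleError_le {s : ℂ} (h1 : 1 < s.re) (h2 : s.re ≤ 2)
    (ht : 1 ≤ |s.im|) :
    DifferentiableAt ℂ (fun s => ∑' n, zetaRectangleError n s) s ∧
    ‖deriv (fun s => ∑' n, zetaRectangleError n s) s‖ ≤
      32 * zetaGrowthConst * (4 + |s.im|) ^ (1 / 8 : ℝ) := by
  have hsub : Metric.closedBall s (1 / 32) ⊆ {s : ℂ | 15 / 16 < s.re} \ {1} := by
    intro z hz
    rw [mem_closedBall_iff_norm] at hz
    have hre := (abs_le.1 ((abs_re_le_norm (z - s)).trans hz)).1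
    have him := (abs_im_le_norm (z - s)).trans hz
    rw [sub_re] at hre
    rw [sub_im] at him
    refine ⟨by simp only [mem_ofPred_eq]; linarith, ?_⟩
    rintro rfl
    simp at him
    norm_num at him
    linarith
  have hopen : IsOpen ({s : ℂ | 15 / 16 < s.re} \ {1}) :=
    (isOpen_lt continuous_const continuous_re).sdiff isClosed_singleton
  have hD := differentiableOn_tsum_zetaRectangleError
  refine ⟨hD.differentiableAt (hopen.mem_nhds (hsub (Metric.mem_closedBall_self (by norm_num)))),
    ?_⟩
  have hcl : DiffContOnCl ℂ (fun s => ∑' n, zetaRectangleError n s) (Metric.ball s (1 / 32)) := by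
    apply DifferentiableOn.diffContOnCl
    exact hD.mono (Metric.closure_ball_subset_closedBall.trans hsub)
  have := Complex.norm_deriv_le_of_forall_mem_sphere_norm_le (by norm_num) hcl
    (C := zetaGrowthConst * (4 + |s.im|) ^ (1 / 8 : ℝ)) (fun z hz => by
      have hz' := hsub (Metric.sphere_subset_closedBall hz)
      refine (norm_tsum_zetaRectangleError_le (le_of_lt hz'.1)).trans ?_
      have := zetaGrowthConst_nonneg
      gcongr
      rw [mem_sphere_iff_norm] at hz
      have e1 : ‖z‖ ≤ ‖z - s‖ + ‖s‖ := by simpa using norm_add_le (z - s) s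
      have e2 := norm_le_abs_re_add_abs_im s
      rw [abs_of_pos (by linarith : 0 < s.re)] at e2
      linarith)
  refine this.trans (le_of_eq ?_)
  ring

theorem norm_riemannZeta_sub_riemannZeta_le {s w : ℂ} (hs : 1 < s.re) (hs2 : s.re ≤ 2)
    (hw : 1 < w.re) (hw2 : w.re ≤ 2) (him : w.im = s.im) (ht : 1 ≤ |s.im|) :
    ‖riemannZeta w - riemannZeta s‖ ≤
      (1 + 32 * zetaGrowthConst) * (4 + |s.im|) ^ (1 / 8 : ℝ) * ‖w - s‖ := by
  -- A horizontal segment: convex, with `|Im| ≥ 1` throughout, so the mean value inequality applies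
  -- away from the pole.
  set S : Set ℂ := {z | 1 < z.re ∧ z.re ≤ 2 ∧ z.im = s.im}
  have hconv : Convex ℝ S := by
    have : S = (reLm ⁻¹' (Ioc 1 2)) ∩ (imLm ⁻¹' {s.im}) := by
      ext z; simp [S, and_assoc]
    rw [this]
    exact ((convex_Ioc 1 2).linear_preimage _).inter ((convex_singleton _).linear_preimage _)
  have hT : 1 ≤ (4 + |s.im|) ^ (1 / 8 : ℝ) :=
    Real.one_le_rpow (by linarith) (by norm_num)
  have hinv : ∀ z ∈ S, HasDerivAt (fun z : ℂ => (z - 1)⁻¹) (-1 / (z - 1) ^ 2) z := fun z hz =>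
    ((hasDerivAt_id z).sub_const 1).inv (fun h => by
      have := congrArg re h
      simp at this
      linarith [hz.1])
  have hd : ∀ z ∈ S, DifferentiableAt ℂ
      (fun z : ℂ => (z - 1)⁻¹ + ∑' n, zetaRectangleError n z) z := fun z hz =>
    (hinv z hz).differentiableAt.add
      (norm_deriv_tsum_zetaRectangleError_le hz.1 hz.2.1 (hz.2.2 ▸ ht)).1
  have hb : ∀ z ∈ S, ‖deriv (fun z : ℂ => (z - 1)⁻¹ + ∑' n, zetaRectangleError n z) z‖ ≤
      (1 + 32 * zetaGrowthConst) * (4 + |s.im|) ^ (1 / 8 : ℝ) := fun z hz => by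
    obtain ⟨hF, hFb⟩ := norm_deriv_tsum_zetaRectangleError_le hz.1 hz.2.1 (hz.2.2 ▸ ht)
    rw [deriv_fun_add (hinv z hz).differentiableAt hF, (hinv z hz).deriv]
    refine (norm_add_le _ _).trans ?_
    rw [hz.2.2] at hFb
    have hz1 : 1 ≤ ‖z - 1‖ := by
      have := abs_im_le_norm (z - 1)
      simp [hz.2.2] at this
      linarith
    have : ‖-1 / (z - 1) ^ 2‖ ≤ 1 := by
      rw [norm_div, norm_neg, norm_one, norm_pow]
      exact div_le_one_of_le₀ (one_le_pow₀ hz1) (by positivity)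
    linarith
  have := hconv.norm_image_sub_le_of_norm_deriv_le hd hb (x := s) (y := w) ⟨hs, hs2, rfl⟩
    ⟨hw, hw2, him⟩
  rwa [← one_div, ← one_div, ← riemannZeta_eq_inv_sub_one_add_tsum hw,
    ← riemannZeta_eq_inv_sub_one_add_tsum hs] at this

theorem norm_riemannZeta_le {s : ℂ} (hs : 1 < s.re) (hs2 : s.re ≤ 2) (ht : 1 ≤ |s.im|) :
    ‖riemannZeta s‖ ≤ (1 + zetaGrowthConst) * (4 + |s.im|) ^ (1 / 8 : ℝ) := by
  rw [riemannZeta_eq_inv_sub_one_add_tsum hs]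
  refine (norm_add_le _ _).trans ?_
  have hz1 : 1 ≤ ‖s - 1‖ := by
    have := abs_im_le_norm (s - 1)
    simp at this
    linarith
  have h1 : ‖1 / (s - 1)‖ ≤ 1 := by
    rw [norm_div, norm_one]; exact div_le_one_of_le₀ hz1 (by positivity)
  have hT : 1 ≤ (4 + |s.im|) ^ (1 / 8 : ℝ) :=
    Real.one_le_rpow (by linarith) (by norm_num)
  have h2 := norm_tsum_zetaRectangleError_le (s := s) (by linarith)
  have h3 : ‖s‖ ^ (1 / 8 : ℝ) ≤ (4 + |s.im|) ^ (1 / 8 : ℝ) := by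
    gcongr
    have e2 := norm_le_abs_re_add_abs_im s
    rw [abs_of_pos (by linarith : 0 < s.re)] at e2
    linarith
  have := mul_le_mul_of_nonneg_left h3 zetaGrowthConst_nonneg
  linarith

theorem norm_riemannZeta_one_add_le {η : ℝ} (h0 : 0 < η) (h1 : η ≤ 1) :
    ‖riemannZeta (1 + η)‖ ≤ (1 + 2 * zetaGrowthConst) / η := by
  have hre : (1 + (η : ℂ)).re = 1 + η := by simp
  rw [riemannZeta_eq_inv_sub_one_add_tsum (by rw [hre]; linarith)]
  refine (norm_add_le _ _).trans ?_
  have h2 := norm_tsum_zetaRectangleError_le (s := 1 + η) (by rw [hre]; linarith)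
  have h3 : ‖(1 + η : ℂ)‖ ^ (1 / 8 : ℝ) ≤ 2 := by
    have : ‖(1 + η : ℂ)‖ = 1 + η := by
      rw [← ofReal_one, ← ofReal_add, norm_real, Real.norm_of_nonneg (by linarith)]
    rw [this]
    exact (Real.rpow_le_self_of_one_le (by linarith) (by norm_num)).trans (by linarith)
  have h4 := mul_le_mul_of_nonneg_left h3 zetaGrowthConst_nonneg
  have h5 : ‖1 / (1 + (η : ℂ) - 1)‖ = 1 / η := by simp [abs_of_pos h0]
  rw [h5, add_div]
  have h6 : 2 * zetaGrowthConst ≤ 2 * zetaGrowthConst / η :=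
    le_div_self (by linarith [zetaGrowthConst_nonneg]) h0 h1
  linarith

/-! ### Lower bound for `ζ` from the 3-4-1 inequality -/

theorem one_le_norm_riemannZeta_product {η : ℝ} (h0 : 0 < η) (t : ℝ) :
    1 ≤ ‖riemannZeta (1 + η)‖ ^ 3 * ‖riemannZeta (1 + η + I * t)‖ ^ 4 *
      ‖riemannZeta (1 + η + 2 * I * t)‖ := by
  have := DirichletCharacter.norm_LFunction_product_ge_one (1 : DirichletCharacter ℂ 1) h0 t
  simpa [DirichletCharacter.LFunctionTrivChar, DirichletCharacter.LFunction_modOne_eq] using this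

/-- A function on `(0, 1]` that is Lipschitz and obeys a lower bound of the 3-4-1 type is bounded
below uniformly. -/
theorem exists_pos_le_mul_pow_of_lipschitz {A B D : ℝ} (hA : 0 < A) (hB : 0 < B) (hD : 0 < D) :
    ∃ c > 0, ∀ u : ℝ, 1 ≤ u → ∀ z : ℝ → ℝ, (∀ η, 0 ≤ z η) →
      (∀ η ∈ Ioc (0 : ℝ) 1, 1 ≤ (A / η) ^ 3 * z η ^ 4 * (D * u)) →
      (∀ η ∈ Ioc (0 : ℝ) 1, ∀ ξ ∈ Ioc (0 : ℝ) 1, |z η - z ξ| ≤ B * u * |η - ξ|) →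
      ∀ η ∈ Ioc (0 : ℝ) 1, c ≤ z η * u ^ 4 := by
  -- `w` normalises the 3-4-1 bound to `η³ w⁴ ≤ u z(η)⁴`.
  obtain ⟨w, hw, hw4⟩ : ∃ w : ℝ, 0 < w ∧ w ^ 4 * (A ^ 3 * D) = 1 := by
    refine ⟨(1 / (A ^ 3 * D)) ^ (1 / 4 : ℝ), by positivity, ?_⟩
    rw [← Real.rpow_natCast, ← Real.rpow_mul (by positivity)]
    norm_num
    field_simp
  set θ := min 1 (w / (2 * B))
  have hθ : 0 < θ := by positivity
  have hθ1 : θ ≤ 1 := min_le_left _ _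
  have hθB : B * θ ≤ w / 2 := by
    calc B * θ ≤ B * (w / (2 * B)) := by gcongr; exact min_le_right _ _
      _ = w / 2 := by field_simp
  refine ⟨θ ^ 3 * w / 2, by positivity, fun u hu z hz h341 hlip => ?_⟩
  have hu0 : 0 < u := by linarith
  -- At `η₀` the 3-4-1 bound reads `z ≥ θ³ w / u⁴`, while the Lipschitz variation on `(0, η₀]` is at
  -- most `B u η₀ = B θ⁴ / u⁴ ≤ θ³ w / (2u⁴)`. Thus at most half is lost below `η₀`.
  set η₀ := θ ^ 4 / u ^ 5
  have hη₀ : 0 < η₀ := by positivity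
  have hη₀1 : η₀ ≤ 1 :=
    div_le_one_of_le₀ ((pow_le_one₀ hθ.le hθ1).trans (one_le_pow₀ hu)) (by positivity)
  have hlarge : ∀ η ∈ Ioc (0 : ℝ) 1, η₀ ≤ η → θ ^ 3 * w ≤ z η * u ^ 4 := by
    intro η hη hle
    have h1 := h341 η hη
    have hη0 := hη.1
    have h2 : η ^ 3 * w ^ 4 ≤ u * z η ^ 4 := by
      have : (A / η) ^ 3 * z η ^ 4 * (D * u) = A ^ 3 * D * (u * z η ^ 4) / η ^ 3 := by
        field_simp
      rw [this, le_div_iff₀ (by positivity), one_mul] at h1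
      calc η ^ 3 * w ^ 4 ≤ A ^ 3 * D * (u * z η ^ 4) * w ^ 4 := by gcongr
        _ = (w ^ 4 * (A ^ 3 * D)) * (u * z η ^ 4) := by ring
        _ = _ := by rw [hw4, one_mul]
    have h3 : (θ ^ 3 * w) ^ 4 ≤ (z η * u ^ 4) ^ 4 := by
      calc (θ ^ 3 * w) ^ 4 = η₀ ^ 3 * w ^ 4 * u ^ 15 := by
            simp only [η₀]; field_simp
        _ ≤ η ^ 3 * w ^ 4 * u ^ 15 := by gcongr
        _ ≤ u * z η ^ 4 * u ^ 15 := by gcongr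
        _ = _ := by ring
    exact le_of_pow_le_pow_left₀ (by norm_num) (mul_nonneg (hz η) (by positivity)) h3
  intro η hη
  have hpos : 0 < θ ^ 3 * w := by positivity
  rcases le_total η₀ η with hle | hle
  · linarith [hlarge η hη hle]
  · have h1 := hlarge η₀ ⟨hη₀, hη₀1⟩ le_rfl
    have h2 := hlip η₀ ⟨hη₀, hη₀1⟩ η hη
    have h3 : z η₀ - z η ≤ B * u * η₀ := by
      refine (le_abs_self _).trans (h2.trans ?_)
      rw [abs_of_nonneg (by linarith)]
      gcongr
      linarith [hη.1]
    have h4 : (z η₀ - z η) * u ^ 4 ≤ B * u * η₀ * u ^ 4 := by gcongr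
    have h5 : B * u * η₀ * u ^ 4 = θ ^ 3 * (B * θ) := by
      simp only [η₀]; field_simp
    have h6 : θ ^ 3 * (B * θ) ≤ θ ^ 3 * (w / 2) := by gcongr
    linarith

theorem exists_pos_le_norm_riemannZeta : ∃ c > 0, ∀ s : ℂ, 1 < s.re → s.re ≤ 2 → 1 ≤ |s.im| →
    c ≤ ‖riemannZeta s‖ * (4 + |s.im|) ^ (1 / 2 : ℝ) := by
  have hG := zetaGrowthConst_nonneg
  obtain ⟨c, hc, H⟩ := exists_pos_le_mul_pow_of_lipschitz (A := 1 + 2 * zetaGrowthConst)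
    (B := 1 + 32 * zetaGrowthConst) (D := (1 + zetaGrowthConst) * 2) (by positivity)
    (by positivity) (by positivity)
  refine ⟨c, hc, fun s hs hs2 ht => ?_⟩
  -- With growth `u = (4+|t|)^{1/8}`, the loss `u⁴` is the exponent `1/2`.
  set u := (4 + |s.im|) ^ (1 / 8 : ℝ) with hu
  have hu1 : 1 ≤ u := Real.one_le_rpow (by linarith) (by norm_num)
  have hu4 : u ^ 4 = (4 + |s.im|) ^ (1 / 2 : ℝ) := by
    rw [hu, ← Real.rpow_natCast, ← Real.rpow_mul (by positivity)]; norm_num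
  have hs' : (1 + ((s.re - 1 : ℝ) : ℂ) + I * s.im) = s := by
    apply Complex.ext <;> simp
  have := H u hu1 (fun η => ‖riemannZeta (1 + η + I * s.im)‖) (fun _ => norm_nonneg _) ?_ ?_
    (s.re - 1) ⟨by linarith, by linarith⟩
  · rwa [hu4, hs'] at this
  · intro η hη
    refine (one_le_norm_riemannZeta_product hη.1 s.im).trans ?_
    have h1 := norm_riemannZeta_one_add_le hη.1 hη.2
    have h2 : ‖riemannZeta (1 + η + 2 * I * s.im)‖ ≤ (1 + zetaGrowthConst) * 2 * u := by
      have hre : (1 + η + 2 * I * s.im : ℂ).re = 1 + η := by simp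
      have him : (1 + η + 2 * I * s.im : ℂ).im = 2 * s.im := by simp
      have h := norm_riemannZeta_le (s := 1 + η + 2 * I * s.im) (by rw [hre]; linarith [hη.1])
        (by rw [hre]; linarith [hη.2]) (by rw [him, abs_mul]; norm_num; linarith)
      rw [him] at h
      refine h.trans ?_
      rw [mul_assoc]
      gcongr
      calc (4 + |2 * s.im|) ^ (1 / 8 : ℝ) ≤ (2 * (4 + |s.im|)) ^ (1 / 8 : ℝ) := by
            gcongr; rw [abs_mul]; norm_num; linarith
        _ = 2 ^ (1 / 8 : ℝ) * u := Real.mul_rpow (by norm_num) (by positivity)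
        _ ≤ 2 * u := by
            gcongr; exact Real.rpow_le_self_of_one_le (by norm_num) (by norm_num)
    have hη0 := hη.1
    gcongr
  · intro η hη ξ hξ
    refine (abs_norm_sub_norm_le _ _).trans ?_
    have h := norm_riemannZeta_sub_riemannZeta_le (s := 1 + ξ + I * s.im)
      (w := 1 + η + I * s.im) (by simp [hξ.1]) (by simp; linarith [hξ.2]) (by simp [hη.1])
      (by simp; linarith [hη.2]) (by simp) (by simpa using ht)
    have e : ‖(1 + η + I * s.im : ℂ) - (1 + ξ + I * s.im)‖ = |η - ξ| := by
      rw [← Real.norm_eq_abs, ← norm_real]; congr 1; push_cast; ring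
    rw [e] at h
    simpa [hu] using h

/-! ### Upper bound for `1/ζ` up to the line `Re s = 1` -/

theorem tendsto_inv_riemannZeta_nhdsNE_one :
    Tendsto (fun s => (riemannZeta s)⁻¹) (𝓝[≠] 1) (𝓝 0) := by
  have h1 := riemannZeta_residue_one.inv₀ one_ne_zero
  have h2 : Tendsto (fun s : ℂ => s - 1) (𝓝[≠] 1) (𝓝 0) := by
    have : Tendsto (fun s : ℂ => s - 1) (𝓝 1) (𝓝 (1 - 1)) :=
      (continuous_id.sub continuous_const).tendsto 1
    rw [sub_self] at this
    exact this.mono_left nhdsWithin_le_nhds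
  have h3 := h2.mul h1
  rw [zero_mul] at h3
  refine h3.congr' ?_
  filter_upwards [self_mem_nhdsWithin] with s hs
  have : s - 1 ≠ 0 := sub_ne_zero.2 hs
  rw [mul_inv, mul_inv_cancel_left₀ this]

theorem continuousAt_inv_riemannZeta {s : ℂ} (hs : 1 ≤ s.re) (hs1 : s ≠ 1) :
    ContinuousAt (fun s => (riemannZeta s)⁻¹) s :=
  (differentiableAt_riemannZeta hs1).continuousAt.inv₀ (riemannZeta_ne_zero_of_one_le_re hs)

theorem exists_norm_inv_riemannZeta_le : ∃ C : ℝ, ∀ s : ℂ, 1 ≤ s.re → s.re < 2 → s ≠ 1 →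
    ‖(riemannZeta s)⁻¹‖ ≤ C * (4 + |s.im|) ^ (1 / 2 : ℝ) := by
  obtain ⟨c, hc, H⟩ := exists_pos_le_norm_riemannZeta
  have hlarge : ∀ s : ℂ, 1 ≤ s.re → s.re < 2 → 1 ≤ |s.im| →
      ‖(riemannZeta s)⁻¹‖ ≤ c⁻¹ * (4 + |s.im|) ^ (1 / 2 : ℝ) := by
    intro s hs hs2 ht
    have hz : 0 < ‖riemannZeta s‖ := norm_pos_iff.2 (riemannZeta_ne_zero_of_one_le_re hs)
    suffices h : c ≤ ‖riemannZeta s‖ * (4 + |s.im|) ^ (1 / 2 : ℝ) by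
      rw [norm_inv, inv_mul_eq_div, le_div_iff₀ hc, inv_mul_le_iff₀ hz]
      exact h
    -- The lower bound is known only for `Re > 1`; it passes to `Re s = 1` by letting `η → 0⁺` in `s
    -- + η`.
    have hs1 : s ≠ 1 := by rintro rfl; norm_num at ht
    have hcont : Tendsto (fun η : ℝ => ‖riemannZeta (s + η)‖ * (4 + |s.im|) ^ (1 / 2 : ℝ))
        (𝓝[>] 0) (𝓝 (‖riemannZeta s‖ * (4 + |s.im|) ^ (1 / 2 : ℝ))) := by
      have e : Tendsto (fun η : ℝ => s + (η : ℂ)) (𝓝[>] 0) (𝓝 s) := by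
        have : Continuous fun η : ℝ => s + (η : ℂ) := by fun_prop
        simpa using (this.tendsto 0).mono_left nhdsWithin_le_nhds
      exact (((differentiableAt_riemannZeta hs1).continuousAt.tendsto.comp e).norm).mul_const _
    refine ge_of_tendsto hcont ?_
    filter_upwards [Ioo_mem_nhdsGT (show (0 : ℝ) < 2 - s.re by linarith)] with η hη
    have := H (s + η) (by simp; linarith [hη.1]) (by simp; linarith [hη.2]) (by simpa using ht)
    simpa using this
  -- For `|Im s| ≤ 1` compactness suffices, once `1/ζ` is given its limit `0` at the pole in place
  -- of the default value there.
  set K : Set ℂ := Icc 1 2 ×ℂ Icc (-1) 1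
  have hK : IsCompact K := isCompact_Icc.reProdIm isCompact_Icc
  have hcont : ContinuousOn (Function.update (fun s => (riemannZeta s)⁻¹) 1 0) K := by
    intro s hs
    apply ContinuousAt.continuousWithinAt
    by_cases h : s = 1
    · subst h
      exact continuousAt_update_same.2 tendsto_inv_riemannZeta_nhdsNE_one
    · exact (continuousAt_update_of_ne h).2 (continuousAt_inv_riemannZeta hs.1.1 h)
  obtain ⟨M, hM⟩ := hK.exists_bound_of_continuousOn hcont
  refine ⟨max M c⁻¹, fun s hs hs2 hs1 => ?_⟩
  rcases le_total 1 |s.im| with ht | ht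
  · refine (hlarge s hs hs2 ht).trans ?_
    gcongr
    exact le_max_right _ _
  · have h := hM s ⟨⟨hs, hs2.le⟩, abs_le.1 ht⟩
    rw [Function.update_of_ne hs1] at h
    have hT : 1 ≤ (4 + |s.im|) ^ (1 / 2 : ℝ) :=
      Real.one_le_rpow (by linarith [abs_nonneg s.im]) (by norm_num)
    exact (h.trans (le_max_left _ _)).trans
      (le_mul_of_one_le_right (le_max_of_le_right (inv_pos.2 hc).le) hT)

/-! ### The kernel `1/(x²+a²)` and its Fourier transform -/

/-- The factors `x ± ia` have imaginary parts `± Re a`. -/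
theorem sq_re_le_norm_sq_add_sq {a : ℂ} (ha : 0 < a.re) (x : ℝ) :
    a.re ^ 2 ≤ ‖(x : ℂ) ^ 2 + a ^ 2‖ := by
  have h : (x : ℂ) ^ 2 + a ^ 2 = (x + I * a) * (x - I * a) := by
    linear_combination a ^ 2 * I_sq
  have h1 : a.re ≤ ‖(x : ℂ) + I * a‖ := by
    have := abs_im_le_norm ((x : ℂ) + I * a)
    simpa [abs_of_pos ha] using this
  have h2 : a.re ≤ ‖(x : ℂ) - I * a‖ := by
    have := abs_im_le_norm ((x : ℂ) - I * a)
    simpa [abs_of_pos ha] using this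
  rw [h, norm_mul, sq]
  gcongr

theorem sq_add_sq_ne_zero {a : ℂ} (ha : 0 < a.re) (x : ℝ) : (x : ℂ) ^ 2 + a ^ 2 ≠ 0 := by
  rw [← norm_pos_iff]
  exact (by positivity : 0 < a.re ^ 2).trans_le (sq_re_le_norm_sq_add_sq ha x)

theorem exists_norm_inv_sq_add_sq_le {a : ℂ} (ha : 0 < a.re) :
    ∃ C : ℝ, 0 ≤ C ∧ ∀ x : ℝ, ‖((x : ℂ) ^ 2 + a ^ 2)⁻¹‖ ≤ C * (1 + x ^ 2)⁻¹ := by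
  refine ⟨1 + (1 + ‖a‖ ^ 2) / a.re ^ 2, by positivity, fun x => ?_⟩
  have h0 := norm_pos_iff.2 (sq_add_sq_ne_zero ha x)
  have h1 : x ^ 2 ≤ ‖(x : ℂ) ^ 2 + a ^ 2‖ + ‖a‖ ^ 2 := by
    have := norm_sub_le ((x : ℂ) ^ 2 + a ^ 2) (a ^ 2)
    rw [add_sub_cancel_right, norm_pow, norm_pow, norm_real, Real.norm_eq_abs, sq_abs] at this
    exact this
  have h2 : 1 + ‖a‖ ^ 2 ≤ (1 + ‖a‖ ^ 2) / a.re ^ 2 * ‖(x : ℂ) ^ 2 + a ^ 2‖ := by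
    rw [div_mul_eq_mul_div, le_div_iff₀ (by positivity)]
    gcongr
    exact sq_re_le_norm_sq_add_sq ha x
  rw [norm_inv, ← div_eq_mul_inv, le_div_iff₀ (by positivity), inv_mul_le_iff₀ h0]
  linarith

theorem continuous_inv_sq_add_sq {a : ℂ} (ha : 0 < a.re) :
    Continuous fun x : ℝ => ((x : ℂ) ^ 2 + a ^ 2)⁻¹ :=
  Continuous.inv₀ (by fun_prop) (sq_add_sq_ne_zero ha)

theorem integrable_inv_sq_add_sq {a : ℂ} (ha : 0 < a.re) :
    Integrable fun x : ℝ => ((x : ℂ) ^ 2 + a ^ 2)⁻¹ := by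
  obtain ⟨C, -, hC⟩ := exists_norm_inv_sq_add_sq_le ha
  exact (integrable_inv_one_add_sq.const_mul C).mono'
    (continuous_inv_sq_add_sq ha).aestronglyMeasurable (ae_of_all _ hC)

-- Fourier inversion for `e^{-a|v|}`, whose transform is `2a/((2πw)²+a²)`, also for complex `a`.
open scoped FourierTransform in
theorem integral_exp_mul_inv_sq_add_sq {a : ℂ} (ha : 0 < a.re) {l : ℝ} (hl : 0 ≤ l) :
    ∫ x : ℝ, exp (-(l * x * I)) * ((x : ℂ) ^ 2 + a ^ 2)⁻¹ = Real.pi / a * exp (-(a * l)) := by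
  have ha0 : a ≠ 0 := by rintro rfl; simp at ha
  set f : ℝ → ℂ := fun v => exp (-(a * |v|)) with hf
  have hfc : Continuous f := by fun_prop
  have hexp : ∀ w : ℝ,
      IntegrableOn (fun v : ℝ => exp (↑(-2 * Real.pi * v * w) * I) • f v) (Iic 0) ∧
      IntegrableOn (fun v : ℝ => exp (↑(-2 * Real.pi * v * w) * I) • f v) (Ioi 0) ∧
      (∫ v : ℝ in Iic 0, exp (↑(-2 * Real.pi * v * w) * I) • f v) =
        1 / (a - 2 * Real.pi * w * I) ∧
      (∫ v : ℝ in Ioi 0, exp (↑(-2 * Real.pi * v * w) * I) • f v) =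
        1 / (a + 2 * Real.pi * w * I) := by
    intro w
    have e1 : EqOn (fun v : ℝ => exp ((a - 2 * Real.pi * w * I) * v))
        (fun v : ℝ => exp (↑(-2 * Real.pi * v * w) * I) • f v) (Iic 0) := by
      intro v hv
      simp only [hf, smul_eq_mul]
      rw [← exp_add, abs_of_nonpos hv]
      congr 1
      push_cast
      ring
    have e2 : EqOn (fun v : ℝ => exp ((-(a + 2 * Real.pi * w * I)) * v))
        (fun v : ℝ => exp (↑(-2 * Real.pi * v * w) * I) • f v) (Ioi 0) := by
      intro v hv
      simp only [hf, smul_eq_mul]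
      rw [← exp_add, abs_of_pos hv]
      congr 1
      push_cast
      ring
    have r1 : 0 < (a - 2 * Real.pi * w * I).re := by simpa using ha
    have r2 : (-(a + 2 * Real.pi * w * I)).re < 0 := by simpa using ha
    refine ⟨(integrableOn_exp_mul_complex_Iic r1 0).congr_fun e1 measurableSet_Iic,
      (integrableOn_exp_mul_complex_Ioi r2 0).congr_fun e2 measurableSet_Ioi, ?_, ?_⟩
    · rw [← setIntegral_congr_fun measurableSet_Iic e1, integral_exp_mul_complex_Iic r1]
      simp
    · rw [← setIntegral_congr_fun measurableSet_Ioi e2, integral_exp_mul_complex_Ioi r2,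
        neg_div_neg_eq]
      simp
  have hfi : Integrable f := by
    obtain ⟨h1, h2, -⟩ := hexp 0
    rw [← integrableOn_univ, ← Iic_union_Ioi (a := (0 : ℝ))]
    simpa using h1.union h2
  have hF : 𝓕 f = fun w : ℝ => 2 * a * (((2 * Real.pi * w : ℝ) : ℂ) ^ 2 + a ^ 2)⁻¹ := by
    ext w
    obtain ⟨h1, h2, h3, h4⟩ := hexp w
    rw [Real.fourier_real_eq_integral_exp_smul, ← intervalIntegral.integral_Iic_add_Ioi h1 h2,
      h3, h4]
    have n1 : a - 2 * Real.pi * w * I ≠ 0 := fun h => by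
      have := congrArg re h
      simp at this
      linarith
    have n2 : a + 2 * Real.pi * w * I ≠ 0 := fun h => by
      have := congrArg re h
      simp at this
      linarith
    have e : ((2 * Real.pi * w : ℝ) : ℂ) ^ 2 + a ^ 2 =
        (a - 2 * Real.pi * w * I) * (a + 2 * Real.pi * w * I) := by
      push_cast
      linear_combination 4 * (Real.pi : ℂ) ^ 2 * (w : ℂ) ^ 2 * I_sq
    rw [e]
    field_simp
    ring
  have hFi : Integrable (𝓕 f) := by
    rw [hF]
    exact ((integrable_inv_sq_add_sq ha).comp_mul_left' (R := 2 * Real.pi)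
      (by positivity)).const_mul _
  -- Evaluating at `-l` matches the sign in `e^{-ilx}`; `f` is even.
  have hinv := congrFun (hfc.fourierInv_fourier_eq hfi hFi) (-l)
  rw [Real.fourierInv_eq', hF] at hinv
  have hsub := Measure.integral_comp_mul_left
    (fun x : ℝ => exp (-(l * x * I)) * ((x : ℂ) ^ 2 + a ^ 2)⁻¹) (2 * Real.pi)
  have hlhs : (∫ v : ℝ, exp (↑(2 * Real.pi * inner ℝ v (-l)) * I) •
      (2 * a * (((2 * Real.pi * v : ℝ) : ℂ) ^ 2 + a ^ 2)⁻¹)) =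
      2 * a * ∫ x : ℝ, exp (-(l * ((2 * Real.pi * x : ℝ) : ℂ) * I)) *
        (((2 * Real.pi * x : ℝ) : ℂ) ^ 2 + a ^ 2)⁻¹ := by
    rw [← integral_const_mul]
    congr 1 with v
    rw [smul_eq_mul, mul_left_comm]
    congr 3
    simp
    ring
  rw [hlhs, hsub, abs_of_pos (by positivity), real_smul] at hinv
  have hfl : f (-l) = exp (-(a * l)) := by simp [hf, abs_of_nonneg hl]
  rw [hfl] at hinv
  have hpi : (Real.pi : ℂ) ≠ 0 := by exact_mod_cast Real.pi_ne_zero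
  rw [← hinv, ← mul_assoc, ← mul_assoc]
  push_cast
  rw [show (Real.pi / a * (2 * a) * (2 * (Real.pi : ℂ))⁻¹ : ℂ) = 1 by field_simp, one_mul]

/-! ### Möbius expansion for `Re b > 1` -/

open ArithmeticFunction in
theorem LSeries_moebius_eq_inv_riemannZeta {s : ℂ} (hs : 1 < s.re) :
    LSeries (fun n => ((moebius n : ℤ) : ℂ)) s = (riemannZeta s)⁻¹ := by
  have h := LSeries_zeta_mul_Lseries_moebius hs
  rw [LSeries_zeta_eq_riemannZeta hs] at h
  exact eq_inv_of_mul_eq_one_right h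

theorem LSeries.term_add_exponent (f : ℕ → ℂ) (s z : ℂ) (n : ℕ) :
    LSeries.term f (s + z) n = LSeries.term f s n * exp (-(z * Real.log n)) := by
  rcases eq_or_ne n 0 with rfl | hn
  · simp
  · have hn' : (n : ℂ) ≠ 0 := by exact_mod_cast hn
    rw [LSeries.term_of_ne_zero hn, LSeries.term_of_ne_zero hn, cpow_add _ _ hn', exp_neg,
      natCast_log, cpow_def_of_ne_zero hn' z, mul_comm z, div_mul_eq_div_div,
      div_eq_mul_inv _ (exp _)]

theorem integral_exp_div_riemannZeta_of_one_lt_re {a b : ℂ} (ha : 0 < a.re) (hb : 1 < b.re) :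
    Integrable (fun x : ℝ => ((x : ℂ) ^ 2 + a ^ 2)⁻¹ *
      (exp (-(I * x)) / riemannZeta (b + I * x))) ∧
    ∫ x : ℝ, ((x : ℂ) ^ 2 + a ^ 2)⁻¹ * (exp (-(I * x)) / riemannZeta (b + I * x)) =
      Real.pi * exp (-a) / (a * riemannZeta (a + b)) := by
  set m : ℕ → ℂ := fun n => ((ArithmeticFunction.moebius n : ℤ) : ℂ) with hm
  have hnorm : ∀ y : ℝ, ‖exp (-(y * I))‖ = 1 := fun y => by
    rw [← neg_mul, ← ofReal_neg, norm_exp_ofReal_mul_I]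
  have hsum : Summable fun n => ‖LSeries.term m b n‖ :=
    (ArithmeticFunction.LSeriesSummable_moebius_iff.2 hb).norm
  have hl : ∀ n : ℕ, (0 : ℝ) ≤ 1 + Real.log n := fun n => by
    have := Real.log_natCast_nonneg n
    linarith
  set G : ℕ → ℝ → ℂ := fun n x => LSeries.term m b n *
    (exp (-(((1 + Real.log n : ℝ) : ℂ) * x * I)) * ((x : ℂ) ^ 2 + a ^ 2)⁻¹) with hG
  have hGterm : ∀ n x, G n x = ((x : ℂ) ^ 2 + a ^ 2)⁻¹ * exp (-(I * x)) *
      LSeries.term m (b + I * x) n := fun n x => by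
    have : exp (-(((1 + Real.log n : ℝ) : ℂ) * x * I)) =
        exp (-(I * x)) * exp (-(I * x * Real.log n)) := by
      rw [← exp_add]; congr 1; push_cast; ring
    simp only [hG]
    rw [LSeries.term_add_exponent, this]
    ring
  have hGnorm : ∀ n x, ‖G n x‖ = ‖LSeries.term m b n‖ * ‖((x : ℂ) ^ 2 + a ^ 2)⁻¹‖ := fun n x => by
    simp only [hG]
    rw [norm_mul, norm_mul, ← ofReal_mul, hnorm, one_mul]
  have hGint : ∀ n, Integrable (G n) := fun n => by
    refine Integrable.mono' ((integrable_inv_sq_add_sq ha).norm.const_mul ‖LSeries.term m b n‖) ?_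
      (ae_of_all _ fun x => (hGnorm n x).le)
    have := continuous_inv_sq_add_sq ha
    exact Continuous.aestronglyMeasurable (by fun_prop)
  have hGsum : ∀ x : ℝ, HasSum (fun n => G n x) (((x : ℂ) ^ 2 + a ^ 2)⁻¹ *
      (exp (-(I * x)) / riemannZeta (b + I * x))) := fun x => by
    have hre : 1 < (b + I * x).re := by simpa using hb
    have h := (ArithmeticFunction.LSeriesSummable_moebius_iff.2 hre).hasSum.mul_left
      (((x : ℂ) ^ 2 + a ^ 2)⁻¹ * exp (-(I * x)))
    have h' := LSeries_moebius_eq_inv_riemannZeta hre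
    rw [LSeries] at h'
    rw [h', mul_assoc, ← div_eq_mul_inv] at h
    simpa only [hGterm] using h
  have hcont : Continuous fun x : ℝ => ((x : ℂ) ^ 2 + a ^ 2)⁻¹ *
      (exp (-(I * x)) / riemannZeta (b + I * x)) := by
    refine (continuous_inv_sq_add_sq ha).mul (Continuous.div (by fun_prop) ?_ fun x =>
      riemannZeta_ne_zero_of_one_lt_re (by simpa using hb))
    refine continuous_iff_continuousAt.2 fun x => ?_
    have hx : b + I * x ≠ 1 := fun h => by
      have := congrArg re h
      simp at this
      linarith
    exact ContinuousAt.comp (f := fun x : ℝ => b + I * x)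
      (differentiableAt_riemannZeta hx).continuousAt (by fun_prop)
  refine ⟨Integrable.mono' ((integrable_inv_sq_add_sq ha).norm.const_mul
    (∑' n, ‖LSeries.term m b n‖)) hcont.aestronglyMeasurable (ae_of_all _ fun x => ?_), ?_⟩
  · rw [← (hGsum x).tsum_eq, ← tsum_mul_right]
    simp only [← hGnorm]
    refine norm_tsum_le_tsum_norm ?_
    simp only [hGnorm]
    exact hsum.mul_right _
  -- The phases have modulus 1, so the integrals of the norms are a constant times the summable
  -- `‖μ(n) n^{-b}‖`.
  · have h := hasSum_integral_of_summable_integral_norm hGint (by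
      simp only [hGnorm, integral_const_mul]
      exact hsum.mul_right _)
    simp only [fun x => (hGsum x).tsum_eq] at h
    have hab : 1 < (b + a).re := by simp; linarith
    have h2 := (ArithmeticFunction.LSeriesSummable_moebius_iff.2 hab).hasSum.mul_left
      (Real.pi / a * exp (-a))
    have h' := LSeries_moebius_eq_inv_riemannZeta hab
    rw [LSeries] at h'
    rw [h'] at h2
    have h3 : ∀ n, ∫ x, G n x = Real.pi / a * exp (-a) * LSeries.term m (b + a) n := fun n => by
      simp only [hG]
      rw [integral_const_mul, integral_exp_mul_inv_sq_add_sq ha (hl n), LSeries.term_add_exponent]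
      have : exp (-(a * ((1 + Real.log n : ℝ) : ℂ))) = exp (-a) * exp (-(a * Real.log n)) := by
        rw [← exp_add]; congr 1; push_cast; ring
      rw [this]
      ring
    simp only [h3] at h
    rw [h.unique h2, add_comm b a]
    field_simp

/-! ### The boundary case `Re b = 1` -/

/-- The dominating function: growth `|x|^{1/2}` against decay `x^{-2}` leaves `|x|^{-3/2}`, which is
integrable. -/
theorem rpow_mul_inv_one_add_sq_le (y x : ℝ) :
    (4 + |y + x|) ^ (1 / 2 : ℝ) * (1 + x ^ 2)⁻¹ ≤
      2 * (4 + |y|) ^ (1 / 2 : ℝ) * (1 + ‖x‖ ^ 2) ^ (-(3 / 2) / 2 : ℝ) := by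
  have h0 : (0 : ℝ) < 1 + x ^ 2 := by positivity
  have h1 : 4 + |y + x| ≤ (4 + |y|) * (4 * (1 + x ^ 2) ^ (1 / 2 : ℝ)) := by
    have e1 := abs_add_le y x
    have e2 : (1 + |x|) ≤ 4 * (1 + x ^ 2) ^ (1 / 2 : ℝ) := by
      rw [← Real.sqrt_eq_rpow]
      have := Real.abs_le_sqrt (show x ^ 2 ≤ 1 + x ^ 2 by linarith)
      have := Real.one_le_sqrt.2 (show 1 ≤ 1 + x ^ 2 by nlinarith)
      linarith
    refine le_trans ?_ (mul_le_mul_of_nonneg_left e2 (by positivity))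
    nlinarith [abs_nonneg y, abs_nonneg x]
  have h2 : (4 + |y + x|) ^ (1 / 2 : ℝ) ≤
      2 * (4 + |y|) ^ (1 / 2 : ℝ) * (1 + x ^ 2) ^ (1 / 4 : ℝ) := by
    refine (Real.rpow_le_rpow (by positivity) h1 (by norm_num)).trans (le_of_eq ?_)
    rw [Real.mul_rpow (by positivity) (by positivity), Real.mul_rpow (by norm_num) (by positivity),
      ← Real.rpow_mul h0.le, show (4 : ℝ) = 2 ^ (2 : ℝ) by norm_num,
      ← Real.rpow_mul (by norm_num)]
    norm_num
    ring
  rw [Real.norm_eq_abs, sq_abs]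
  calc _ ≤ 2 * (4 + |y|) ^ (1 / 2 : ℝ) * (1 + x ^ 2) ^ (1 / 4 : ℝ) * (1 + x ^ 2) ^ (-1 : ℝ) := by
        rw [Real.rpow_neg_one]; gcongr
    _ = _ := by rw [mul_assoc, ← Real.rpow_add h0]; norm_num

theorem integral_exp_div_riemannZeta_of_re_eq_one {a b : ℂ} (ha : 0 < a.re) (hb : b.re = 1) :
    Integrable (fun x : ℝ => ((x : ℂ) ^ 2 + a ^ 2)⁻¹ *
      (exp (-(I * x)) / riemannZeta (b + I * x))) ∧
    ∫ x : ℝ, ((x : ℂ) ^ 2 + a ^ 2)⁻¹ * (exp (-(I * x)) / riemannZeta (b + I * x)) =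
      Real.pi * exp (-a) / (a * riemannZeta (a + b)) := by
  obtain ⟨C, hC⟩ := exists_norm_inv_riemannZeta_le
  obtain ⟨D, hD0, hD⟩ := exists_norm_inv_sq_add_sq_le ha
  set h : ℂ → ℝ → ℂ := fun b x => ((x : ℂ) ^ 2 + a ^ 2)⁻¹ *
      (exp (-(I * x)) / riemannZeta (b + I * x)) with hh
  -- The shift `+ 2` keeps `ε k < 1`, hence `Re (b + ε k) < 2`.
  set ε : ℕ → ℝ := fun k => 1 / ((k : ℝ) + 2) with hε
  have hεpos : ∀ k, 0 < ε k := fun k => by simp only [hε]; positivity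
  have hεlt : ∀ k, ε k < 1 := fun k => by
    simp only [hε]
    rw [div_lt_one (by positivity)]
    linarith [(Nat.cast_nonneg k : (0 : ℝ) ≤ k)]
  have hεlim : Tendsto ε atTop (𝓝 0) :=
    tendsto_const_nhds.div_atTop
      (tendsto_atTop_add_const_right _ _ tendsto_natCast_atTop_atTop)
  have hblim : Tendsto (fun k => b + (ε k : ℂ)) atTop (𝓝 b) := by
    have : Continuous fun η : ℝ => b + (η : ℂ) := by fun_prop
    simpa [Function.comp_def] using (this.tendsto 0).comp hεlim
  have hbound : ∀ (z : ℂ) (x : ℝ), 1 ≤ z.re → z.re < 2 → z.im = b.im → z + I * x ≠ 1 →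
      ‖h z x‖ ≤ D * |C| * (2 * (4 + |b.im|) ^ (1 / 2 : ℝ)) *
        (1 + ‖x‖ ^ 2) ^ (-(3 / 2) / 2 : ℝ) := by
    intro z x h1 h2 h3 h4
    have e : ‖exp (-(I * x))‖ = 1 := by
      rw [← mul_neg, ← ofReal_neg, norm_exp_I_mul_ofReal]
    have hz := hC (z + I * x) (by simpa using h1) (by simpa using h2) h4
    have him : (z + I * x).im = b.im + x := by simp [h3]
    rw [him] at hz
    simp only [hh]
    rw [div_eq_mul_inv, norm_mul, norm_mul, e, one_mul]
    calc _ ≤ (D * (1 + x ^ 2)⁻¹) * (|C| * (4 + |b.im + x|) ^ (1 / 2 : ℝ)) := by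
          gcongr
          · exact hD x
          · exact hz.trans (by gcongr; exact le_abs_self C)
      _ = D * |C| * ((4 + |b.im + x|) ^ (1 / 2 : ℝ) * (1 + x ^ 2)⁻¹) := by ring
      _ ≤ D * |C| * (2 * (4 + |b.im|) ^ (1 / 2 : ℝ) * (1 + ‖x‖ ^ 2) ^ (-(3 / 2) / 2 : ℝ)) := by
          exact mul_le_mul_of_nonneg_left (rpow_mul_inv_one_add_sq_le _ _) (by positivity)
      _ = _ := by ring
  have hbi : Integrable fun x : ℝ => D * |C| * (2 * (4 + |b.im|) ^ (1 / 2 : ℝ)) *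
        (1 + ‖x‖ ^ 2) ^ (-(3 / 2) / 2 : ℝ) :=
    (integrable_rpow_neg_one_add_norm_sq (by norm_num)).const_mul _
  -- Only `x = -Im b` can meet the pole, a null set.
  have hne : ∀ᵐ x : ℝ, b + I * x ≠ 1 := by
    filter_upwards [compl_mem_ae_iff.2 (measure_singleton (-b.im))] with x hx h
    refine hx ?_
    have := congrArg im h
    simp at this
    simp only [mem_singleton_iff]
    linarith
  have hlim : ∀ᵐ x : ℝ, Tendsto (fun k => h (b + ε k) x) atTop (𝓝 (h b x)) := by
    filter_upwards [hne] with x hx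
    have h1 : Tendsto (fun k => b + (ε k : ℂ) + I * x) atTop (𝓝 (b + I * x)) :=
      hblim.add_const _
    have h2 := (differentiableAt_riemannZeta hx).continuousAt.tendsto.comp h1
    exact tendsto_const_nhds.mul (tendsto_const_nhds.div h2
      (riemannZeta_ne_zero_of_one_le_re (by simp [hb])))
  have hk : ∀ k, Integrable (h (b + ε k)) ∧ ∫ x, h (b + ε k) x =
      Real.pi * exp (-a) / (a * riemannZeta (a + (b + ε k))) := fun k =>
    integral_exp_div_riemannZeta_of_one_lt_re ha (by simp [hb, hεpos k])
  refine ⟨hbi.mono' (aestronglyMeasurable_of_tendsto_ae atTop (fun k => (hk k).1.1) hlim) ?_, ?_⟩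
  · filter_upwards [hne] with x hx
    exact hbound b x hb.ge (by linarith) rfl hx
  · have hint : Tendsto (fun k => ∫ x, h (b + ε k) x) atTop (𝓝 (∫ x, h b x)) := by
      refine tendsto_integral_of_dominated_convergence _ (fun k => (hk k).1.1) hbi
        (fun k => ae_of_all _ fun x => ?_) hlim
      refine hbound _ x (by simp [hb, (hεpos k).le]) ?_ (by simp) fun H => ?_
      · have := hεlt k
        simp [hb]
        linarith
      · have := congrArg re H
        simp [hb, (hεpos k).ne'] at this
    refine tendsto_nhds_unique hint ?_
    simp only [fun k => (hk k).2]
    have ha0 : a ≠ 0 := by rintro rfl; simp at ha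
    have hab : 1 < (a + b).re := by simp [hb, ha]
    have hab1 : a + b ≠ 1 := by intro h; rw [h] at hab; simp at hab
    have h1 := (differentiableAt_riemannZeta hab1).continuousAt.tendsto.comp
      (hblim.const_add a)
    exact tendsto_const_nhds.div (tendsto_const_nhds.mul h1)
      (mul_ne_zero ha0 (riemannZeta_ne_zero_of_one_lt_re hab))

theorem integral_exp_div_riemannZeta {a b : ℂ} (ha : 0 < a.re) (hb : 1 ≤ b.re) :
    Integrable (fun x : ℝ => ((x : ℂ) ^ 2 + a ^ 2)⁻¹ *
      (exp (-(I * x)) / riemannZeta (b + I * x))) ∧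
    ∫ x : ℝ, ((x : ℂ) ^ 2 + a ^ 2)⁻¹ * (exp (-(I * x)) / riemannZeta (b + I * x)) =
      Real.pi * exp (-a) / (a * riemannZeta (a + b)) := by
  rcases hb.lt_or_eq with h | h
  · exact integral_exp_div_riemannZeta_of_one_lt_re ha h
  · exact integral_exp_div_riemannZeta_of_re_eq_one ha h.symm

/-! ### Folding onto the half-line -/

theorem integral_Ioi_add_comp_neg {E : Type*} [NormedAddCommGroup E] [NormedSpace ℝ E]
    {f : ℝ → E} (hf : Integrable f) :
    IntegrableOn (fun x => f x + f (-x)) (Ioi 0) ∧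
      ∫ x in Ioi 0, (f x + f (-x)) = ∫ x, f x := by
  have h1 : IntegrableOn f (Ioi 0) := hf.integrableOn
  have h2 : IntegrableOn (fun x => f (-x)) (Ioi 0) := hf.comp_neg.integrableOn
  refine ⟨h1.add h2, ?_⟩
  rw [integral_add h1 h2, integral_comp_neg_Ioi, neg_zero, add_comm,
    intervalIntegral.integral_Iic_add_Ioi hf.integrableOn hf.integrableOn]

theorem integral_Ioi_exp_div_riemannZeta_symm {a b : ℂ} (ha : 0 < a.re) (hb : 1 ≤ b.re) :
    IntegrableOn (fun x : ℝ => 1 / ((x : ℂ) ^ 2 + a ^ 2) *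
      ((exp (-(I * x)) / riemannZeta (b + I * x) +
        exp (I * x) / riemannZeta (b - I * x)) / 2)) (Ioi 0) ∧
    ∫ x : ℝ in Ioi 0, 1 / ((x : ℂ) ^ 2 + a ^ 2) *
      ((exp (-(I * x)) / riemannZeta (b + I * x) +
        exp (I * x) / riemannZeta (b - I * x)) / 2) =
      Real.pi * exp (-a) / (2 * a * riemannZeta (a + b)) := by
  obtain ⟨h1, h2⟩ := integral_exp_div_riemannZeta ha hb
  obtain ⟨h3, h4⟩ := integral_Ioi_add_comp_neg h1
  have e : (fun x : ℝ => 1 / ((x : ℂ) ^ 2 + a ^ 2) *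
      ((exp (-(I * x)) / riemannZeta (b + I * x) +
        exp (I * x) / riemannZeta (b - I * x)) / 2)) = fun x : ℝ =>
      (((x : ℂ) ^ 2 + a ^ 2)⁻¹ * (exp (-(I * x)) / riemannZeta (b + I * x)) +
      ((((-x : ℝ) : ℂ)) ^ 2 + a ^ 2)⁻¹ * (exp (-(I * ((-x : ℝ) : ℂ))) /
        riemannZeta (b + I * ((-x : ℝ) : ℂ)))) / 2 := by
    ext x
    push_cast
    rw [neg_sq, mul_neg, neg_neg, ← sub_eq_add_neg]
    ring
  rw [e]
  refine ⟨h3.div_const 2, ?_⟩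
  rw [integral_div, h4, h2, div_div]
  congr 1
  ring

/-- For real `b`, `ζ(conj s) = conj ζ(s)` makes the two summands conjugate. -/
theorem ofReal_re_exp_div_riemannZeta (b x : ℝ) :
    (((exp (-(I * x)) / riemannZeta (b + I * x)).re : ℝ) : ℂ) =
      (exp (-(I * x)) / riemannZeta (b + I * x) + exp (I * x) / riemannZeta (b - I * x)) / 2 := by
  rw [re_eq_add_conj, map_div₀, ← exp_conj, ← riemannZeta_conj]
  simp [← sub_eq_add_neg]

end

/-- For `Re a > 0`: first the identity with the literal real part, for real `b ≥ 1`
(so that `g x = e^{-x} / ζ(b + x)` is real-valued on `[0, ∞)`); then the identity for every complex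
`b` with `Re b ≥ 1`, where `Re g(ix)` is `(g(ix) + g(-ix)) / 2`, its analytic continuation
in `b`. Absolute convergence of the integrals is part of the claim. -/
theorem mainTheorem12 (a : ℂ) (ha : 0 < a.re) :
    (∀ b : ℝ, 1 ≤ b →
      MeasureTheory.IntegrableOn
        (fun x : ℝ => 1 / ((x : ℂ) ^ 2 + a ^ 2) *
          (((Complex.exp (-(Complex.I * x)) / riemannZeta (b + Complex.I * x)).re : ℝ) : ℂ))
        (Set.Ioi 0) ∧
      ∫ x : ℝ in Set.Ioi 0, 1 / ((x : ℂ) ^ 2 + a ^ 2) *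
          (((Complex.exp (-(Complex.I * x)) / riemannZeta (b + Complex.I * x)).re : ℝ) : ℂ)
        = Real.pi * Complex.exp (-a) / (2 * a * riemannZeta (a + b))) ∧
    (∀ b : ℂ, 1 ≤ b.re →
      MeasureTheory.IntegrableOn
        (fun x : ℝ => 1 / ((x : ℂ) ^ 2 + a ^ 2) *
          ((Complex.exp (-(Complex.I * x)) / riemannZeta (b + Complex.I * x) +
            Complex.exp (Complex.I * x) / riemannZeta (b - Complex.I * x)) / 2))
        (Set.Ioi 0) ∧
      ∫ x : ℝ in Set.Ioi 0, 1 / ((x : ℂ) ^ 2 + a ^ 2) *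
          ((Complex.exp (-(Complex.I * x)) / riemannZeta (b + Complex.I * x) +
            Complex.exp (Complex.I * x) / riemannZeta (b - Complex.I * x)) / 2)
        = Real.pi * Complex.exp (-a) / (2 * a * riemannZeta (a + b))) := by
  refine ⟨fun b hb => ?_, fun b hb => integral_Ioi_exp_div_riemannZeta_symm ha hb⟩
  simp only [ofReal_re_exp_div_riemannZeta]
  exact integral_Ioi_exp_div_riemannZeta_symm ha hb
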